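/- **Conventions.** A cardinal is identified with its initial ordinal, and $[\mu]^k$ is the set of $k$-element subsets of $\mu$, listed increasingly as $w=\{\alpha_0<\dots<\alpha_{k-1}\}$. A filter is $\lambda$-complete if it is closed under intersections of fewer than $\lambda$ members. A filter $D$ on $[\mu]^k$ is *normal for* a sequence of ordinals $\langle\beta_0,\dots,\beta_{k-1}\rangle$ if $\{w:\alpha_\ell<\beta_\ell\text{ for all }\ell<k\}\in D$ and, whenever $\beta'_\ell\le\beta_\ell$ for all $\ell<k$ and $\beta'_n<\beta_n$ for some $n<k$, the complement of $\{w:\alpha_\ell<\beta'_\ell\text{ for all }\ell<k\}$ belongs to $D$. For a Boolean term $\tau(x_0,\dots,x_{k-1})$, a Boolean algebra $B$ has the *$(D,\tau)$-dependence property* if for every sequence $\langle a_i:i<\mu\rangle$ in $B$ there is $A\in D$ such that $\tau(a_{\alpha_0},\dots,a_{\alpha_{k-1}})=0$ for every $\{\alpha_0<\dots<\alpha_{k-1}\}\in A$. An *interval Boolean algebra* is a Boolean algebra isomorphic, for some linear order $I$, to the algebra of subsets of $I$ generated by the half-open intervals $[x,y)$, $x,y\in I\cup\{-\infty,\infty\}$.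 A function $f:\mu\to\mu$ is *regressive* if $f(\alpha)<1+\alpha$ for all $\alpha<\mu$. **Theorem.** Let $\kappa$ be an infinite cardinal and let $\mu$ be an (infinite) regular cardinal such that $\chi^\kappa<\mu$ for every cardinal $\chi<\mu$. (1) For a closed unbounded $C\subseteq\mu$, a regressive $f:\mu\to\mu$ and a function $g:\mu^2\to\chi$ with $\chi<\mu$, let $A_{C,f,g}$ be the set of all $\{\alpha_0<\dots<\alpha_5\}\in[\mu]^6$ such that every $\alpha_\ell$ is in $C$ and has cofinality $>\kappa$, $f(\alpha_0)=\dots=f(\alpha_5)$, and $g(\alpha_0,\alpha_1)=g(\alpha_0,\alpha_2)=g(\alpha_3,\alpha_4)=g(\alpha_3,\alpha_5)$. Let $D^6_{\mu,\kappa}$ be the filter on $[\mu]^6$ generated by all these sets, and let $\tau_6=x_0\wedge(-x_1)\wedge x_2\wedge(-x_3)\wedge x_4\wedge(-x_5)$. Then $D^6_{\mu,\kappa}$ is proper, $\kappa^+$-complete and normal for $\langle\mu,\mu,\mu,\mu,\mu,\mu\rangle$, and every interval Boolean algebra has the $(D^6_{\mu,\kappa},\tau_6)$-dependence property. (2) Let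 moreover $\mu_0$ be an infinite cardinal with $\mu_0^\kappa=\mu_0$ and $(2^{\mu_0})^+\le\mu$. For a closed unbounded $C\subseteq\mu$, a regressive $f:\mu\to\mu$ and a function $g:\mu^2\to\mu_0$, let $A^*_{C,f,g}$ be the set of all $\{\alpha_0<\dots<\alpha_3\}\in[\mu]^4$ such that every $\alpha_\ell$ is in $C$ and has cofinality $>\kappa$, $f(\alpha_0)=\dots=f(\alpha_3)$, and $g(\alpha_0,\alpha_2)=g(\alpha_0,\alpha_3)=g(\alpha_1,\alpha_2)=g(\alpha_1,\alpha_3)$. Let $D^4_{\mu,\kappa}$ be the $\kappa$-complete filter on $[\mu]^4$ generated by all these sets, and let $\tau_4=x_0\wedge(-x_1)\wedge x_2\wedge(-x_3)$. Then $D^4_{\mu,\kappa}$ is proper, $\kappa^+$-complete and normal for $\langle\mu,\mu,\mu,\mu\rangle$, and every interval Boolean algebra has the $(D^4_{\mu,\kappa},\tau_4)$-dependence property. -/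

import Mathlib

open Cardinal Ordinal

universe u v

namespace IntervalDependence

/-- `[lam]^k`: the `k`-element sets of ordinals below (the initial ordinal of) `lam`. -/
abbrev Tup (lam : Cardinal.{u}) (k : ℕ) : Type u := Set.powersetCard lam.ord.ToType k

/-- The `l`-th member of `w`, in the increasing enumeration of `w`. -/
noncomputable def nth {lam : Cardinal.{u}} {k : ℕ} (w : Tup lam k) (l : Fin k) :
    lam.ord.ToType :=
  (w : Finset lam.ord.ToType).orderEmbOfFin w.2 l

/-- The ordinal that an element of `lam.ord.ToType` stands for. -/
noncomputable def ordOf {lam : Cardinal.{u}} (x : lam.ord.ToType) : Ordinal.{u} :=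
  (Ordinal.ToType.toOrd x : Ordinal.{u})

/-- The set of `w ∈ [lam]^k` whose `l`-th member is smaller than `α l`, for every `l < k`. -/
def below (lam : Cardinal.{u}) {k : ℕ} (α : Fin k → Ordinal.{u}) : Set (Tup lam k) :=
  {w | ∀ l, ordOf (nth w l) < α l}

/-- The filter `D` on `[lam]^k` is normal for the sequence `α` of ordinals. -/
structure NormalFor {lam : Cardinal.{u}} {k : ℕ} (D : Filter (Tup lam k))
    (α : Fin k → Ordinal.{u}) : Prop where
  below_mem : below lam α ∈ D
  below_null : ∀ α' : Fin k → Ordinal.{u}, (∀ l, α' l ≤ α l) → (∃ n, α' n < α n) →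
    (below lam α')ᶜ ∈ D

/-- Boolean terms in the variables `x_0, …, x_{k-1}`. -/
inductive BTerm (k : ℕ) : Type
  | var : Fin k → BTerm k
  | zero : BTerm k
  | one : BTerm k
  | neg : BTerm k → BTerm k
  | meet : BTerm k → BTerm k → BTerm k
  | join : BTerm k → BTerm k → BTerm k

/-- The value of a Boolean term in a Boolean algebra. -/
def BTerm.eval {k : ℕ} {B : Type v} [BooleanAlgebra B] (a : Fin k → B) : BTerm k → B
  | .var i => a i
  | .zero => ⊥
  | .one => ⊤
  | .neg s => (s.eval a)ᶜ
  | .meet s t => s.eval a ⊓ t.eval a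
  | .join s t => s.eval a ⊔ t.eval a

/-- The `(D, τ)`-dependence property of the Boolean algebra `B`. -/
def DependenceProperty {lam : Cardinal.{u}} {k : ℕ} (D : Filter (Tup lam k)) (τ : BTerm k)
    (B : Type v) [BooleanAlgebra B] : Prop :=
  ∀ a : lam.ord.ToType → B, ∃ A ∈ D, ∀ w ∈ A, τ.eval (fun l => a (nth w l)) = ⊥

/-- The interval algebra of a linear order `I`: the algebra of subsets of `I` generated by the
half-open intervals `[x, y)` with `x, y ∈ I ∪ {-∞, ∞}`. (If `I` has a least element `m`, then
`[-∞, y)` and `[m, y)` are the same subset of `I`.) -/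
def intervalAlgebra (I : Type v) [LinearOrder I] : BooleanSubalgebra (Set I) :=
  BooleanSubalgebra.closure
    {s | ∃ x y : WithBot (WithTop I),
      s = {z : I | x ≤ ((z : WithTop I) : WithBot (WithTop I)) ∧
        ((z : WithTop I) : WithBot (WithTop I)) < y}}

/-- An interval Boolean algebra: one isomorphic to the interval algebra of a linear order. -/
def IsIntervalAlgebra (B : Type v) [BooleanAlgebra B] : Prop :=
  ∃ (I : Type v) (_ : LinearOrder I), Nonempty (B ≃o intervalAlgebra I)

/-- Regressive functions on `mu`: `f(α) < 1 + α` for all `α < mu`. -/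
def Regressive {mu : Cardinal.{u}} (f : mu.ord.ToType → mu.ord.ToType) : Prop :=
  ∀ x, ordOf (f x) < 1 + ordOf x

/-- The sets `A_{C,f,g} ⊆ [mu]^6`. -/
def A6 {mu : Cardinal.{u}} (kappa : Cardinal.{u}) {X : Type u} (C : Set mu.ord.ToType)
    (f : mu.ord.ToType → mu.ord.ToType) (g : mu.ord.ToType → mu.ord.ToType → X) :
    Set (Tup mu 6) :=
  {w | (∀ l, nth w l ∈ C) ∧ (∀ l, kappa < (ordOf (nth w l)).cof) ∧
    (∀ l, f (nth w 0) = f (nth w l)) ∧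
    g (nth w 0) (nth w 1) = g (nth w 0) (nth w 2) ∧
    g (nth w 0) (nth w 2) = g (nth w 3) (nth w 4) ∧
    g (nth w 3) (nth w 4) = g (nth w 3) (nth w 5)}

/-- The filter `D⁶_{mu,kappa}` on `[mu]^6` generated by the sets `A_{C,f,g}`, where `C` is a club
of `mu`, `f` is regressive and `g : mu × mu → χ` for some cardinal `χ < mu`. -/
def D6 (mu kappa : Cardinal.{u}) : Filter (Tup mu 6) :=
  Filter.generate
    {A | ∃ (C : Set mu.ord.ToType) (f : mu.ord.ToType → mu.ord.ToType) (χ : Cardinal.{u})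
      (g : mu.ord.ToType → mu.ord.ToType → χ.ord.ToType),
      IsClub C ∧ Regressive f ∧ χ < mu ∧ A = A6 kappa C f g}

/-- The sets `A*_{C,f,g} ⊆ [mu]^4`. -/
def A4 {mu : Cardinal.{u}} (kappa : Cardinal.{u}) {X : Type u} (C : Set mu.ord.ToType)
    (f : mu.ord.ToType → mu.ord.ToType) (g : mu.ord.ToType → mu.ord.ToType → X) :
    Set (Tup mu 4) :=
  {w | (∀ l, nth w l ∈ C) ∧ (∀ l, kappa < (ordOf (nth w l)).cof) ∧
    (∀ l, f (nth w 0) = f (nth w l)) ∧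
    g (nth w 0) (nth w 2) = g (nth w 0) (nth w 3) ∧
    g (nth w 0) (nth w 3) = g (nth w 1) (nth w 2) ∧
    g (nth w 1) (nth w 2) = g (nth w 1) (nth w 3)}

/-- The `kappa`-complete filter `D⁴_{mu,kappa}` on `[mu]^4` generated by the sets `A*_{C,f,g}`,
where `C` is a club of `mu`, `f` is regressive and `g : mu × mu → mu0`. -/
def D4 (mu kappa mu0 : Cardinal.{u}) (hkappa : ℵ₀ ≤ kappa) : Filter (Tup mu 4) :=
  Filter.cardinalGenerate (c := kappa)
    {A | ∃ (C : Set mu.ord.ToType) (f : mu.ord.ToType → mu.ord.ToType)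
      (g : mu.ord.ToType → mu.ord.ToType → mu0.ord.ToType),
      IsClub C ∧ Regressive f ∧ A = A4 kappa C f g}
    ((Cardinal.ofNat_lt_aleph0 (n := 2)).trans_le hkappa)

/-- `x₀ ∧ -x₁ ∧ x₂ ∧ -x₃ ∧ x₄ ∧ -x₅`. -/
def tau6 : BTerm 6 :=
  .meet (.meet (.meet (.meet (.meet (.var 0) (.neg (.var 1))) (.var 2)) (.neg (.var 3)))
    (.var 4)) (.neg (.var 5))

/-- `x₀ ∧ -x₁ ∧ x₂ ∧ -x₃`. -/
def tau4 : BTerm 4 :=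
  .meet (.meet (.meet (.var 0) (.neg (.var 1))) (.var 2)) (.neg (.var 3))

end IntervalDependence

open IntervalDependence

/-! An element `a_x` of an interval algebra is given by a finite set `T x` of cuts and a set `V x ⊆
ℕ`: a point `z` belongs to `a_x` iff the number of cuts at or below `z` lies in `V x`. Let `t x n`
be the `n`-th cut and let `g_n(x, y)` be the number of cuts of `a_x` at or below `t y n`. Modulo the
filter, `V` is constant along a tuple and every `g_n` is constant on the prescribed pairs. If `z`
lies in `a_y` but not in `a_y'`, then `z` separates `t y n` from `t y' n` for some `n`, so `g_n(x,
y) = g_n(x, y')` determines how many cuts of `a_x` are at or below `z`.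

For `tau4`, the indices 2 and 3 determine the same count for indices 0 and 1, so `z` cannot
distinguish `a_0` from `a_1`. For `tau6`, the indices 1, 2 determine the count for 0, and 4, 5 that
for 3, but through possibly different `n` and `n'`. Pressing down
(`Admissible.eventually_separated`) shows that both give the same value.

Completeness holds because the generating sets already form a base directed under `kappa` many
intersections: `kappa` colourings merge into a product, and `kappa` regressive functions merge into
one, since at a point of cofinality above `kappa` their values are bounded and there are fewer than
`mu` bounded sequences. Properness is pressing down on a club followed by pigeonhole. -/

namespace IntervalDependence

/-! ### Clubs, cofinalities and pressing down on a regular cardinal. -/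

section RegularOrder

variable {mu kappa : Cardinal.{u}}

theorem ordOf_lt_ordOf {x y : mu.ord.ToType} : ordOf x < ordOf y ↔ x < y := by
  unfold ordOf
  rw [Subtype.coe_lt_coe, OrderIso.lt_iff_lt]

theorem cof_toType_of_isRegular (hmu : mu.IsRegular) : Order.cof mu.ord.ToType = mu := by
  rw [cof_toType, hmu.cof_ord]

theorem cof_ordOf (x : mu.ord.ToType) : (ordOf x).cof = Order.cof (Set.Iio x) :=
  (Order.cof_Iio x).symm

theorem exists_forall_lt_of_mk_lt (hmu : mu.IsRegular) {s : Set mu.ord.ToType} (hs : #s < mu) :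
    ∃ x, ∀ y ∈ s, y < x := by
  rw [← not_isCofinal_iff]
  intro h
  exact (cof_toType_of_isRegular hmu ▸ Order.cof_le h).not_gt hs

theorem exists_forall_lt_of_family (hmu : mu.IsRegular) {ι : Type u} (hι : #ι < mu)
    (f : ι → mu.ord.ToType) : ∃ x, ∀ i, f i < x := by
  obtain ⟨x, hx⟩ := exists_forall_lt_of_mk_lt hmu (mk_range_le.trans_lt hι : #(Set.range f) < mu)
  exact ⟨x, fun i => hx _ ⟨i, rfl⟩⟩

theorem mk_Iic_lt_card (hmu : mu.IsRegular) (x : mu.ord.ToType) : #(Set.Iic x) < mu := by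
  simpa using Cardinal.mk_Iic_lt x (by simp) (by simpa using hmu.aleph0_le)

/-- Fewer than `cof x` elements below `x` are bounded below `x`. -/
theorem exists_lt_forall_lt_of_lt_cof {x : mu.ord.ToType} {ι : Type u}
    (hι : #ι < (ordOf x).cof) (f : ι → mu.ord.ToType) (hf : ∀ i, f i < x) :
    ∃ y < x, ∀ i, f i < y := by
  rw [cof_ordOf] at hι
  let g : ι → Set.Iio x := fun i => ⟨f i, hf i⟩
  have h : ¬ IsCofinal (Set.range g) := fun h =>
    (Order.cof_le h).not_gt (mk_range_le.trans_lt hι)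
  obtain ⟨y, hy⟩ := not_isCofinal_iff.1 h
  exact ⟨y, y.2, fun i => hy _ ⟨i, rfl⟩⟩

/-- The points closed under a function form a club. -/
theorem isClub_setOf_forall_lt (hmu : mu.IsRegular) (hmu' : ℵ₀ < mu)
    (h : mu.ord.ToType → mu.ord.ToType) : IsClub {x | ∀ y < x, h y < x} := by
  refine ⟨?_, ?_⟩
  · intro d hd _ _ a ha y hy
    obtain ⟨z, hz, hyz⟩ := (lt_isLUB_iff ha).1 hy
    exact (hd hz y hyz).trans_le (ha.1 hz)
  · intro a
    have key : ∀ x : mu.ord.ToType, ∃ x', x < x' ∧ ∀ y ≤ x, h y < x' := by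
      intro x
      obtain ⟨z, hz⟩ := exists_forall_lt_of_family hmu (mk_Iic_lt_card hmu x) (fun y => h y.1)
      obtain ⟨w, hw⟩ := exists_forall_lt_of_mk_lt hmu
        (s := {x}) (by simpa using hmu.nat_lt 1)
      refine ⟨max z w, lt_max_of_lt_right (hw x rfl), fun y hy => lt_max_of_lt_left (hz ⟨y, hy⟩)⟩
    choose s hs hs' using key
    -- The supremum of the iterates of `s` is closed under `h`; it exists because `mu` is regular
    -- and uncountable.
    let g : ℕ → mu.ord.ToType := Nat.rec a fun _ IH => s IH
    obtain ⟨b, hb⟩ := exists_forall_lt_of_mk_lt hmu (s := Set.range g)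
      ((Set.countable_range g).le_aleph0.trans_lt hmu')
    obtain ⟨c, hc⟩ : ∃ c, IsLeast (upperBounds (Set.range g)) c :=
      WellFounded.has_min (wellFounded_lt) (upperBounds (Set.range g)) ⟨b, fun y hy => (hb y hy).le⟩
        |>.imp fun c hc => ⟨hc.1, fun y hy => not_lt.1 (hc.2 y hy)⟩
    refine ⟨c, fun y hy => ?_, hc.1 ⟨0, rfl⟩⟩
    obtain ⟨_, ⟨n, rfl⟩, hn⟩ := (lt_isLUB_iff hc).1 hy
    exact (hs' _ y hn.le).trans_le (hc.1 ⟨n + 1, rfl⟩)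

/-- Every club contains points of large cofinality. -/
theorem exists_mem_lt_cof_of_isClub (hmu : mu.IsRegular) (hkappa : ℵ₀ ≤ kappa)
    (hlt : Order.succ kappa < mu) {C : Set mu.ord.ToType} (hC : IsClub C) :
    ∃ x ∈ C, kappa < (ordOf x).cof := by
  have : IsRegularCardinalOrder mu.ord.ToType := ⟨by simp [hmu.cof_ord]⟩
  let e := Order.enum C hC.isCofinal
  -- The supremum of the first `kappa⁺` members of `C` has cofinality `kappa⁺`.
  let m : mu.ord.ToType := ToType.mk ⟨(Order.succ kappa).ord, by simpa using hlt⟩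
  have hm : ordOf m = (Order.succ kappa).ord := by simp [ordOf, m, ToType.toOrd]
  have hlim : ∀ y < m, ∃ z < m, y < z := by
    intro y hy
    obtain ⟨z, hz, h⟩ := exists_lt_forall_lt_of_lt_cof (x := m) (ι := PUnit)
      (by rw [hm, (isRegular_succ hkappa).cof_ord, mk_punit]
          exact (one_lt_aleph0.trans_le hkappa).trans (Order.lt_succ kappa)) (fun _ => y) (fun _ => hy)
    exact ⟨z, hz, h ⟨⟩⟩
  have hne : ∃ y, y < m := by
    by_contra! h
    have h0 : IsEmpty (Set.Iio m) := ⟨fun y => (h y.1).not_gt y.2⟩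
    have := cof_ordOf m
    rw [Order.cof_eq_zero, hm, (isRegular_succ hkappa).cof_ord] at this
    exact (Order.bot_lt_succ kappa).ne' this
  obtain ⟨x, hx⟩ : ∃ x, IsLUB ((fun y => (e y : mu.ord.ToType)) '' Set.Iio m) x := by
    obtain ⟨c, hc, hc'⟩ := WellFounded.has_min (wellFounded_lt)
      (upperBounds ((fun y => (e y : mu.ord.ToType)) '' Set.Iio m))
      ⟨e m, by rintro _ ⟨y, hy, rfl⟩; exact (e.monotone (le_of_lt hy))⟩
    exact ⟨c, hc, fun y hy => not_lt.1 (hc' y hy)⟩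
  have hlt' : ∀ y < m, (e y : mu.ord.ToType) < x := by
    intro y hy
    obtain ⟨z, hz, hyz⟩ := hlim y hy
    exact lt_of_lt_of_le (b := (e z : mu.ord.ToType)) (e.strictMono hyz) (hx.1 ⟨z, hz, rfl⟩)
  refine ⟨x, hC.isLUB_mem ?_ ?_ hx, ?_⟩
  · rintro _ ⟨y, _, rfl⟩
    exact (e y).2
  · obtain ⟨y, hy⟩ := hne
    exact ⟨_, y, hy, rfl⟩
  · let F : Set.Iio m → Set.Iio x := fun y => ⟨e y, hlt' y y.2⟩
    have hF : StrictMono F := fun a b hab => e.strictMono hab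
    have hF' : IsCofinal (Set.range F) := by
      intro a
      obtain ⟨_, ⟨y, hy, rfl⟩, hay⟩ := (lt_isLUB_iff hx).1 a.2
      exact ⟨_, ⟨⟨y, hy⟩, rfl⟩, hay.le⟩
    rw [cof_ordOf, ← Order.cof_congr_of_strictMono hF hF', ← cof_ordOf, hm,
      (isRegular_succ hkappa).cof_ord]
    exact Order.lt_succ kappa

theorem omega0_le_ordOf (hkappa : ℵ₀ ≤ kappa) {x : mu.ord.ToType}
    (hx : kappa < (ordOf x).cof) : ω ≤ ordOf x :=
  omega0_le_of_isSuccLimit (one_lt_cof_iff.1 (one_lt_aleph0.trans_le (hkappa.trans hx.le)))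

theorem Regressive.lt (hkappa : ℵ₀ ≤ kappa) {f : mu.ord.ToType → mu.ord.ToType}
    (hf : Regressive f) {x : mu.ord.ToType} (hx : kappa < (ordOf x).cof) : f x < x := by
  rw [← ordOf_lt_ordOf]
  simpa [one_add_of_omega0_le (omega0_le_ordOf hkappa hx)] using hf x

theorem regressive_of_lt_or_isMin {f : mu.ord.ToType → mu.ord.ToType}
    (hf : ∀ x, f x < x ∨ IsMin (f x)) : Regressive f := by
  intro x
  obtain h | h := hf x
  · exact (ordOf_lt_ordOf.2 h).trans_le le_add_self
  · have h0 : ordOf (f x) = 0 := by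
      by_contra h0
      have hpos : (0 : Ordinal) < ordOf (f x) := _root_.pos_iff_ne_zero.2 h0
      let y : mu.ord.ToType := ToType.mk ⟨0, hpos.trans (ToType.toOrd (f x)).2⟩
      have hy : ordOf y = 0 := by simp [ordOf, y, ToType.toOrd]
      exact h.not_lt (ordOf_lt_ordOf.1 (hy ▸ hpos) : y < f x)
    rw [h0]
    exact zero_lt_one.trans_le le_self_add

/-- A regressive function is constant on an unbounded set of points of large cofinality in any
given club. -/
theorem Regressive.exists_unbounded_fiber (hmu : mu.IsRegular) (hkappa : ℵ₀ ≤ kappa)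
    (hlt : Order.succ kappa < mu) {C : Set mu.ord.ToType} (hC : IsClub C)
    {f : mu.ord.ToType → mu.ord.ToType} (hf : Regressive f) :
    ∃ c, ∀ b, ∃ x, b ≤ x ∧ x ∈ C ∧ kappa < (ordOf x).cof ∧ f x = c := by
  by_contra! h
  choose b hb using h
  have hmu' : ℵ₀ < mu := (hkappa.trans (Order.le_succ kappa)).trans_lt hlt
  -- If every fibre were bounded, by `b`, a point `x` closed under `b` would exceed the bound `b (f
  -- x)` of its own fibre, as `f x < x`.
  obtain ⟨x, ⟨hxC, hxb⟩, hx⟩ := exists_mem_lt_cof_of_isClub hmu hkappa hlt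
    (hC.inter (by rw [cof_toType_of_isRegular hmu]; exact hmu'.ne') (isClub_setOf_forall_lt hmu hmu' b))
  exact hb (f x) x (hxb _ (hf.lt hkappa hx)).le hxC hx rfl

end RegularOrder

/-! ### The common form of both filters: completeness and normality. -/

section PatternFilter

variable {mu kappa : Cardinal.{u}} {k : ℕ}

/-- An injective coding of a continuously increasing union of small sets such that on a club,
the codes of the elements that appeared before `x` are smaller than `x`. -/
theorem exists_code (hmu : mu.IsRegular) (hmu' : ℵ₀ < mu) {Z : Type u}
    (Y : mu.ord.ToType → Set Z) (hY : ∀ x, #(Y x) < mu) :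
    ∃ (c : Z → mu.ord.ToType) (E : Set mu.ord.ToType), IsClub E ∧
      Set.InjOn c (⋃ x, Y x) ∧ ∀ x ∈ E, ∀ y < x, ∀ z ∈ Y y, c z < x := by
  have hcard : #(⋃ x, Y x) ≤ #mu.ord.ToType := by
    refine (mk_iUnion_le_sum_mk.trans (sum_le_sum _ (fun _ => mu) fun x => (hY x).le)).trans ?_
    simp [mul_eq_self hmu.aleph0_le]
  obtain ⟨j⟩ := hcard
  have : Nonempty mu.ord.ToType := by simpa using hmu.ne_zero
  classical
  let c : Z → mu.ord.ToType := fun z =>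
    if h : z ∈ ⋃ x, Y x then j ⟨z, h⟩ else Classical.arbitrary _
  have hb : ∀ x, ∃ b, ∀ z : Y x, c z < b := fun x =>
    exists_forall_lt_of_family hmu (hY x) (fun z => c z)
  choose b hb using hb
  refine ⟨c, _, isClub_setOf_forall_lt hmu hmu' b, ?_, fun x hx y hy z hz =>
    (hb y ⟨z, hz⟩).trans (hx y hy)⟩
  intro z hz z' hz' h
  simp only [c, dif_pos hz, dif_pos hz'] at h
  simpa using j.injective h

/-- `A6` and `A4` with an arbitrary set `E` of pairs on which `g` is required to be constant. -/
def patSet (kappa : Cardinal.{u}) (E : Set (Fin k × Fin k)) {X : Type u} (C : Set mu.ord.ToType)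
    (f : mu.ord.ToType → mu.ord.ToType) (g : mu.ord.ToType → mu.ord.ToType → X) :
    Set (Tup mu k) :=
  {w | (∀ l, nth w l ∈ C) ∧ (∀ l, kappa < (ordOf (nth w l)).cof) ∧
    (∀ l m, f (nth w l) = f (nth w m)) ∧
    ∀ p ∈ E, ∀ q ∈ E, g (nth w p.1) (nth w p.2) = g (nth w q.1) (nth w q.2)}

theorem patSet_comp_of_injective (E : Set (Fin k × Fin k)) {X Y : Type u}
    (C : Set mu.ord.ToType) (f : mu.ord.ToType → mu.ord.ToType)
    (g : mu.ord.ToType → mu.ord.ToType → X) {j : X → Y} (hj : Function.Injective j) :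
    patSet kappa E C f (fun x y => j (g x y)) = patSet kappa E C f g := by
  simp only [patSet, hj.eq_iff]

/-- The sets `patSet kappa E C f g`, where the number of colours of `g` satisfies `P`. -/
def patBase (mu kappa : Cardinal.{u}) (E : Set (Fin k × Fin k)) (P : Cardinal.{u} → Prop) :
    Set (Set (Tup mu k)) :=
  {A | ∃ (C : Set mu.ord.ToType) (f : mu.ord.ToType → mu.ord.ToType) (X : Type u)
    (g : mu.ord.ToType → mu.ord.ToType → X),
    IsClub C ∧ Regressive f ∧ P #X ∧ A = patSet kappa E C f g}

/-- The filter generated by the sets in `patBase mu kappa E P`. -/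
def patFilter (mu kappa : Cardinal.{u}) (E : Set (Fin k × Fin k)) (P : Cardinal.{u} → Prop) :
    Filter (Tup mu k) :=
  Filter.generate (patBase mu kappa E P)

/-- The hypotheses on `mu`, `kappa` and the admissible numbers of colours. -/
structure Admissible (mu kappa : Cardinal.{u}) (P : Cardinal.{u} → Prop) : Prop where
  aleph0_le : ℵ₀ ≤ kappa
  isRegular : mu.IsRegular
  power_lt : ∀ χ < mu, χ ^ kappa < mu
  pi : ∀ (ι : Type u) (X : ι → Type u), #ι ≤ kappa → (∀ i, P #(X i)) → P #(∀ i, X i)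
  aleph0 : P ℵ₀

theorem succ_lt_of_power_lt (hmu : mu.IsRegular)
    (hpow : ∀ χ < mu, χ ^ kappa < mu) : Order.succ kappa < mu := by
  refine lt_of_le_of_lt (Order.succ_le_of_lt (cantor kappa)) (hpow 2 ?_)
  exact_mod_cast hmu.nat_lt 2

variable {P : Cardinal.{u} → Prop}

theorem Admissible.succ_lt (h : Admissible mu kappa P) : Order.succ kappa < mu :=
  succ_lt_of_power_lt h.isRegular h.power_lt

theorem Admissible.aleph0_lt (h : Admissible mu kappa P) : ℵ₀ < mu :=
  (h.aleph0_le.trans (Order.le_succ kappa)).trans_lt h.succ_lt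

theorem Admissible.one (h : Admissible mu kappa P) : P 1 := by
  simpa using h.pi PEmpty (fun _ => PUnit) (by simp) (by simp)

theorem Admissible.exists_isMin (h : Admissible mu kappa P) : ∃ o : mu.ord.ToType, IsMin o := by
  have : Nonempty mu.ord.ToType := by simpa using h.isRegular.ne_zero
  obtain ⟨o, -, ho⟩ := WellFounded.has_min (wellFounded_lt) (Set.univ : Set mu.ord.ToType)
    Set.univ_nonempty
  exact ⟨o, fun y _ => not_lt.1 (ho y trivial)⟩

/-- `kappa` many regressive functions are coded by one, on the points of large cofinality of a
club. -/
theorem Admissible.exists_regressive_code (h : Admissible mu kappa P) {ι : Type u}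
    (hι : #ι ≤ kappa) (f : ι → mu.ord.ToType → mu.ord.ToType) (hf : ∀ i, Regressive (f i)) :
    ∃ (F : mu.ord.ToType → mu.ord.ToType) (E : Set mu.ord.ToType), Regressive F ∧ IsClub E ∧
      ∀ x ∈ E, ∀ y ∈ E, kappa < (ordOf x).cof → kappa < (ordOf y).cof → F x = F y →
        ∀ i, f i x = f i y := by
  -- Stage `x` collects the sequences bounded by `x`; there are at most `#(Set.Iic x) ^ kappa < mu`
  -- of them.
  obtain ⟨c, E, hE, hinj, hc⟩ := exists_code h.isRegular h.aleph0_lt (Z := ι → mu.ord.ToType)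
    (fun x => {s | ∀ i, s i ≤ x}) (fun x => by
      have e : {s : ι → mu.ord.ToType | ∀ i, s i ≤ x} ≃ (ι → Set.Iic x) :=
        ⟨fun s i => ⟨s.1 i, s.2 i⟩, fun s => ⟨fun i => s i, fun i => (s i).2⟩,
          fun _ => rfl, fun _ => rfl⟩
      rw [mk_congr e, ← power_def]
      refine lt_of_le_of_lt (power_le_power_left ?_ hι) (h.power_lt _ (mk_Iic_lt_card h.isRegular x))
      exact mk_ne_zero_iff.2 ⟨⟨x, le_refl x⟩⟩)
  obtain ⟨o, ho⟩ := h.exists_isMin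
  have key : ∀ x, kappa < (ordOf x).cof → ∃ y < x, ∀ i, f i x < y := fun x hx =>
    exists_lt_forall_lt_of_lt_cof (hι.trans_lt hx) _ fun i => (hf i).lt h.aleph0_le hx
  classical
  have hlt : ∀ x ∈ E, kappa < (ordOf x).cof → c (fun i => f i x) < x := fun x hxE hx => by
    obtain ⟨y, hy, hfy⟩ := key x hx
    exact hc x hxE y hy _ fun i => (hfy i).le
  -- The default `o` only makes the function regressive everywhere; it is never taken at points of
  -- `E` of large cofinality.
  refine ⟨fun x => if c (fun i => f i x) < x then c (fun i => f i x) else o, E,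
    regressive_of_lt_or_isMin fun x => ?_, hE, ?_⟩
  · by_cases hx : c (fun i => f i x) < x
    · simp [hx]
    · simp [hx, ho]
  · intro x hx y hy hx' hy' hF i
    simp only [hlt x hx hx', hlt y hy hy', if_true] at hF
    refine congrFun (hinj ?_ ?_ hF) i
    · obtain ⟨z, -, hz⟩ := key x hx'
      exact Set.mem_iUnion.2 ⟨z, fun i => (hz i).le⟩
    · obtain ⟨z, -, hz⟩ := key y hy'
      exact Set.mem_iUnion.2 ⟨z, fun i => (hz i).le⟩

theorem Admissible.exists_mem_patBase_subset_iInter (h : Admissible mu kappa P)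
    {E : Set (Fin k × Fin k)} {ι : Type u} (hι : #ι ≤ kappa) {A : ι → Set (Tup mu k)}
    (hA : ∀ i, A i ∈ patBase mu kappa E P) :
    ∃ B ∈ patBase mu kappa E P, B ⊆ ⋂ i, A i := by
  choose C f X g hC hf hX hA using hA
  obtain ⟨F, E', hF, hE', hcode⟩ := h.exists_regressive_code hι f hf
  have hcof : Order.cof mu.ord.ToType ≠ ℵ₀ := by
    rw [cof_toType_of_isRegular h.isRegular]
    exact h.aleph0_lt.ne'
  refine ⟨_, ⟨E' ∩ ⋂ i, C i, F, ∀ i, X i, fun x y i => g i x y, ?_, hF, h.pi ι X hι hX, rfl⟩, ?_⟩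
  · refine hE'.inter hcof (IsClub.iInter hcof ?_ hC)
    rw [Cardinal.lift_lt, cof_toType_of_isRegular h.isRegular]
    exact (hι.trans (Order.le_succ kappa)).trans_lt h.succ_lt
  · rintro w ⟨hw, hwcof, hwF, hwg⟩
    refine Set.mem_iInter.2 fun i => ?_
    rw [hA i]
    exact ⟨fun l => Set.mem_iInter.1 (hw l).2 i, hwcof,
      fun l m => hcode _ (hw l).1 _ (hw m).1 (hwcof l) (hwcof m) (hwF l m) i,
      fun p hp q hq => congrFun (hwg p hp q hq) i⟩

/-- The generating sets are directed downwards, so they form a base and not merely a subbase. -/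
theorem Admissible.mem_patFilter_iff (h : Admissible mu kappa P) {E : Set (Fin k × Fin k)}
    {s : Set (Tup mu k)} :
    s ∈ patFilter mu kappa E P ↔ ∃ A ∈ patBase mu kappa E P, A ⊆ s := by
  refine ⟨fun hs => ?_, fun ⟨A, hA, hAs⟩ => Filter.mem_of_superset (.basic hA) hAs⟩
  induction hs with
  | basic hs => exact ⟨_, hs, subset_rfl⟩
  | univ =>
    obtain ⟨B, hB, -⟩ := h.exists_mem_patBase_subset_iInter (E := E) (ι := PEmpty) (by simp)
      (A := fun i => i.elim) (fun i => i.elim)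
    exact ⟨B, hB, Set.subset_univ _⟩
  | superset _ hst ih =>
    obtain ⟨A, hA, hAs⟩ := ih
    exact ⟨A, hA, hAs.trans hst⟩
  | inter _ _ ih₁ ih₂ =>
    obtain ⟨A, hA, hAs⟩ := ih₁
    obtain ⟨A', hA', hAs'⟩ := ih₂
    obtain ⟨B, hB, hBA⟩ := h.exists_mem_patBase_subset_iInter (E := E) (ι := ULift Bool)
      ((mk_le_aleph0).trans h.aleph0_le) (A := fun i => if i.down then A else A')
      (by rintro ⟨_ | _⟩ <;> simp [hA, hA'])
    refine ⟨B, hB, Set.subset_inter (hBA.trans ?_) (hBA.trans ?_)⟩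
    · exact (Set.iInter_subset _ ⟨true⟩).trans (by simpa using hAs)
    · exact (Set.iInter_subset _ ⟨false⟩).trans (by simpa using hAs')

theorem Admissible.cardinalInterFilter (h : Admissible mu kappa P) (E : Set (Fin k × Fin k)) :
    CardinalInterFilter (patFilter mu kappa E P) (Order.succ kappa) := by
  refine ⟨fun S hS hSm => ?_⟩
  have hSm' : ∀ s : S, ∃ A ∈ patBase mu kappa E P, A ⊆ s.1 := fun s =>
    h.mem_patFilter_iff.1 (hSm s.1 s.2)
  choose A hA hAs using hSm'
  obtain ⟨B, hB, hBA⟩ := h.exists_mem_patBase_subset_iInter (Order.lt_succ_iff.1 hS) hA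
  refine h.mem_patFilter_iff.2 ⟨B, hB, fun w hw s hs => ?_⟩
  exact hAs ⟨s, hs⟩ (Set.mem_iInter.1 (hBA hw) ⟨s, hs⟩)

theorem Admissible.countableInterFilter (h : Admissible mu kappa P) (E : Set (Fin k × Fin k)) :
    CountableInterFilter (patFilter mu kappa E P) := by
  have := h.cardinalInterFilter E
  exact CardinalInterFilter.toCountableInterFilter _
    (Order.lt_succ_of_le h.aleph0_le)

theorem Admissible.eventually_mem (h : Admissible mu kappa P) (E : Set (Fin k × Fin k))
    {C : Set mu.ord.ToType} (hC : IsClub C) :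
    ∀ᶠ w in patFilter mu kappa E P, ∀ l, nth w l ∈ C := by
  obtain ⟨o, ho⟩ := h.exists_isMin
  refine h.mem_patFilter_iff.2 ⟨_, ⟨C, fun _ => o, PUnit, fun _ _ => ⟨⟩, hC,
    regressive_of_lt_or_isMin fun _ => .inr ho, by simpa using h.one, rfl⟩, fun w hw => hw.1⟩

theorem Admissible.eventually_lt_cof (h : Admissible mu kappa P) (E : Set (Fin k × Fin k)) :
    ∀ᶠ w in patFilter mu kappa E P, ∀ l, kappa < (ordOf (nth w l)).cof := by
  obtain ⟨o, ho⟩ := h.exists_isMin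
  refine h.mem_patFilter_iff.2 ⟨_, ⟨Set.univ, fun _ => o, PUnit, fun _ _ => ⟨⟩, .univ,
    regressive_of_lt_or_isMin fun _ => .inr ho, by simpa using h.one, rfl⟩, fun w hw => hw.2.1⟩

theorem Admissible.eventually_regressive_eq (h : Admissible mu kappa P)
    (E : Set (Fin k × Fin k)) {f : mu.ord.ToType → mu.ord.ToType} (hf : Regressive f) :
    ∀ᶠ w in patFilter mu kappa E P, ∀ l m, f (nth w l) = f (nth w m) :=
  h.mem_patFilter_iff.2 ⟨_, ⟨Set.univ, f, PUnit, fun _ _ => ⟨⟩, .univ, hf,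
    by simpa using h.one, rfl⟩, fun _ hw => hw.2.2.1⟩

theorem Admissible.eventually_colour_eq (h : Admissible mu kappa P)
    (E : Set (Fin k × Fin k)) (g : mu.ord.ToType → mu.ord.ToType → ℕ) :
    ∀ᶠ w in patFilter mu kappa E P, ∀ p ∈ E, ∀ q ∈ E,
      g (nth w p.1) (nth w p.2) = g (nth w q.1) (nth w q.2) := by
  obtain ⟨o, ho⟩ := h.exists_isMin
  refine h.mem_patFilter_iff.2 ⟨_, ⟨Set.univ, fun _ => o, ULift.{u} ℕ, fun x y => ⟨g x y⟩, .univ,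
    regressive_of_lt_or_isMin fun _ => .inr ho, by simpa using h.aleph0, rfl⟩,
    fun w hw p hp q hq => by simpa using hw.2.2.2 p hp q hq⟩

/-- Values coded by finite ordinals are regressive at every point of large cofinality, such a point
being at least `ω`. -/
theorem Admissible.eventually_countable_eq (h : Admissible mu kappa P)
    (E : Set (Fin k × Fin k)) {Y : Type*} [Countable Y] (f : mu.ord.ToType → Y) :
    ∀ᶠ w in patFilter mu kappa E P, ∀ l m, f (nth w l) = f (nth w m) := by
  obtain ⟨o, ho⟩ := h.exists_isMin
  obtain ⟨j, hj⟩ := exists_injective_nat Y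
  have hω : ω ≤ mu.ord := by simpa using h.isRegular.aleph0_le
  let c : Y → mu.ord.ToType := fun y => ToType.mk ⟨(j y : ℕ), (natCast_lt_omega0 _).trans_le hω⟩
  have hc : ∀ y, ordOf (c y) = j y := fun y => by simp [c, ordOf, ToType.toOrd]
  classical
  let F : mu.ord.ToType → mu.ord.ToType := fun x => if c (f x) < x then c (f x) else o
  have hF : Regressive F := regressive_of_lt_or_isMin fun x => by
    by_cases hx : c (f x) < x
    · simp [F, hx]
    · simp [F, hx, ho]
  filter_upwards [h.eventually_regressive_eq E hF, h.eventually_lt_cof E] with w hw hw' l m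
  have hlt : ∀ l, c (f (nth w l)) < nth w l := fun l => by
    rw [← ordOf_lt_ordOf, hc]
    exact (natCast_lt_omega0 _).trans_le (omega0_le_ordOf h.aleph0_le (hw' l))
  have := hw l m
  simp only [F, hlt, if_true] at this
  have h2 := congrArg ordOf this
  rw [hc, hc] at h2
  exact hj (by exact_mod_cast h2)

theorem Admissible.normalFor (h : Admissible mu kappa P) (E : Set (Fin k × Fin k)) :
    NormalFor (patFilter mu kappa E P) (fun _ => mu.ord) := by
  refine ⟨Filter.mem_of_superset Filter.univ_mem fun w _ l => (ToType.toOrd (nth w l)).2, ?_⟩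
  rintro α' - ⟨n, hn⟩
  let a : mu.ord.ToType := ToType.mk ⟨α' n, hn⟩
  have ha : ordOf a = α' n := by simp [a, ordOf, ToType.toOrd]
  have hC : IsClub (Set.Ici a) := by
    refine ⟨fun d hd ⟨y, hy⟩ _ b hb => (hd hy).trans (hb.1 hy), fun b => ?_⟩
    exact ⟨max a b, Set.mem_Ici.2 (le_max_left _ _), le_max_right _ _⟩
  filter_upwards [h.eventually_mem E hC] with w hw hw'
  have h1 := hw' n
  rw [← ha, ordOf_lt_ordOf] at h1
  exact h1.not_ge (hw n)

end PatternFilter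

/-! ### Identification of the two filters and their properness. -/

section Proper

variable {mu kappa mu0 : Cardinal.{u}} {k : ℕ} {P : Cardinal.{u} → Prop}

/-- The pairs on which the colouring is constant in the definition of `A6`. -/
def pairs6 : Set (Fin 6 × Fin 6) := {(0, 1), (0, 2), (3, 4), (3, 5)}

/-- The pairs on which the colouring is constant in the definition of `A4`. -/
def pairs4 : Set (Fin 4 × Fin 4) := {(0, 2), (0, 3), (1, 2), (1, 3)}

theorem A6_eq_patSet {X : Type u} (C : Set mu.ord.ToType) (f : mu.ord.ToType → mu.ord.ToType)
    (g : mu.ord.ToType → mu.ord.ToType → X) : A6 kappa C f g = patSet kappa pairs6 C f g := by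
  ext w
  refine and_congr_right fun _ => and_congr_right fun _ => and_congr
    ⟨fun h l m => (h l).symm.trans (h m), fun h l => h 0 l⟩ ?_
  simp only [pairs6, Set.mem_insert_iff, Set.mem_singleton_iff, forall_eq_or_imp, forall_eq]
  grind

theorem A4_eq_patSet {X : Type u} (C : Set mu.ord.ToType) (f : mu.ord.ToType → mu.ord.ToType)
    (g : mu.ord.ToType → mu.ord.ToType → X) : A4 kappa C f g = patSet kappa pairs4 C f g := by
  ext w
  refine and_congr_right fun _ => and_congr_right fun _ => and_congr
    ⟨fun h l m => (h l).symm.trans (h m), fun h l => h 0 l⟩ ?_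
  simp only [pairs4, Set.mem_insert_iff, Set.mem_singleton_iff, forall_eq_or_imp, forall_eq]
  grind

theorem D6_eq_patFilter : D6 mu kappa = patFilter mu kappa pairs6 (· < mu) := by
  unfold D6 patFilter
  congr 1
  ext A
  constructor
  · rintro ⟨C, f, χ, g, hC, hf, hχ, rfl⟩
    exact ⟨C, f, _, g, hC, hf, by simpa using hχ, A6_eq_patSet C f g⟩
  · rintro ⟨C, f, X, g, hC, hf, hX, rfl⟩
    obtain ⟨e⟩ : Nonempty (X ≃ (#X).ord.ToType) := Cardinal.eq.1 (by simp)
    exact ⟨C, f, #X, fun x y => e (g x y), hC, hf, hX, by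
      rw [A6_eq_patSet, patSet_comp_of_injective pairs6 C f g e.injective]⟩

theorem admissible_lt (hkappa : ℵ₀ ≤ kappa) (hmu : mu.IsRegular)
    (hpow : ∀ χ < mu, χ ^ kappa < mu) : Admissible mu kappa (· < mu) := by
  have hlt := succ_lt_of_power_lt hmu hpow
  refine ⟨hkappa, hmu, hpow, fun ι X hι hX => ?_, (hkappa.trans (Order.le_succ _)).trans_lt hlt⟩
  -- The 1 keeps the base nonzero, so that its powers are monotone in the exponent.
  let s : Cardinal := max 1 (⨆ i, #(X i))
  have hs : s < mu := max_lt (by exact_mod_cast hmu.nat_lt 1)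
    (Cardinal.iSup_lt_of_lt_cof_ord (by
      rw [hmu.cof_ord]; exact (hι.trans (Order.le_succ _)).trans_lt hlt) hX)
  rw [mk_pi]
  calc Cardinal.prod (fun i => #(X i)) ≤ Cardinal.prod (fun _ : ι => s) :=
        prod_le_prod _ _ fun i => (le_ciSup Cardinal.bddAbove_of_small i).trans (le_max_right _ _)
    _ = s ^ #ι := by simp
    _ ≤ s ^ kappa := power_le_power_left (zero_lt_one.trans_le (le_max_left _ _)).ne' hι
    _ < mu := hpow s hs

theorem admissible_le (hkappa : ℵ₀ ≤ kappa) (hmu : mu.IsRegular)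
    (hpow : ∀ χ < mu, χ ^ kappa < mu) (hmu0 : ℵ₀ ≤ mu0) (hmu0' : mu0 ^ kappa = mu0) :
    Admissible mu kappa (· ≤ mu0) := by
  refine ⟨hkappa, hmu, hpow, fun ι X hι hX => ?_, hmu0⟩
  rw [mk_pi]
  calc Cardinal.prod (fun i => #(X i)) ≤ Cardinal.prod (fun _ : ι => mu0) :=
        prod_le_prod _ _ hX
    _ = mu0 ^ #ι := by simp
    _ ≤ mu0 ^ kappa := power_le_power_left (aleph0_pos.trans_le hmu0).ne' hι
    _ = mu0 := hmu0'

/-- The plainly generated filter is already `kappa⁺`-complete, so closing under fewer than `kappa`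
intersections adds nothing. -/
theorem D4_eq_patFilter (h : Admissible mu kappa (· ≤ mu0)) (hkappa : ℵ₀ ≤ kappa) :
    D4 mu kappa mu0 hkappa = patFilter mu kappa pairs4 (· ≤ mu0) := by
  have hbase : {A : Set (Tup mu 4) | ∃ (C : Set mu.ord.ToType)
      (f : mu.ord.ToType → mu.ord.ToType) (g : mu.ord.ToType → mu.ord.ToType → mu0.ord.ToType),
      IsClub C ∧ Regressive f ∧ A = A4 kappa C f g} = patBase mu kappa pairs4 (· ≤ mu0) := by
    ext A
    constructor
    · rintro ⟨C, f, g, hC, hf, rfl⟩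
      exact ⟨C, f, _, g, hC, hf, by simp, A4_eq_patSet C f g⟩
    · rintro ⟨C, f, X, g, hC, hf, hX, rfl⟩
      obtain ⟨e⟩ : Nonempty (X ↪ mu0.ord.ToType) := by
        rw [← Cardinal.le_def]
        simpa using hX
      exact ⟨C, f, fun x y => e (g x y), hC, hf, by
        rw [A4_eq_patSet, patSet_comp_of_injective pairs4 C f g e.injective]⟩
  unfold D4
  rw [hbase]
  have := h.cardinalInterFilter pairs4
  have := CardinalInterFilter.of_cardinalInterFilter_of_le (c := Order.succ kappa)
    (patFilter mu kappa pairs4 (· ≤ mu0)) (Order.le_succ kappa)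
  refine le_antisymm ?_ ?_
  · exact (Filter.le_generate_iff).2 fun s hs => Filter.CardinalGenerateSets.basic hs
  · exact (Filter.le_cardinalGenerate_iff_of_cardinalInterFilter _).2 fun s hs => .basic hs

theorem exists_nth_eq {v : Fin k → mu.ord.ToType} (hv : StrictMono v) :
    ∃ w : Tup mu k, ∀ l, nth w l = v l := by
  classical
  refine ⟨⟨Finset.univ.image v, ?_⟩, fun l => ?_⟩
  · simp [Set.powersetCard, Finset.card_image_of_injective _ hv.injective]
  · exact (congrFun (Finset.orderEmbOfFin_unique _ (fun x => by simp) hv) l).symm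

/-- Pressing down disposes of the club and the regressive function, leaving a pure colouring problem
on a cofinal set. -/
theorem Admissible.neBot_patFilter (h : Admissible mu kappa P) (E : Set (Fin k × Fin k))
    (hE : ∀ (S : Set mu.ord.ToType) (X : Type u) (g : mu.ord.ToType → mu.ord.ToType → X),
      IsCofinal S → P #X → ∃ v : Fin k → mu.ord.ToType, StrictMono v ∧ (∀ l, v l ∈ S) ∧
        ∀ p ∈ E, ∀ q ∈ E, g (v p.1) (v p.2) = g (v q.1) (v q.2)) :
    (patFilter mu kappa E P).NeBot := by
  refine Filter.neBot_iff.2 fun hbot => ?_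
  obtain ⟨_, ⟨C, f, X, g, hC, hf, hX, rfl⟩, hA⟩ :=
    h.mem_patFilter_iff.1 (Filter.empty_mem_iff_bot.2 hbot)
  obtain ⟨c, hc⟩ := hf.exists_unbounded_fiber h.isRegular h.aleph0_le h.succ_lt hC
  obtain ⟨v, hv, hvS, hvg⟩ := hE {x | x ∈ C ∧ kappa < (ordOf x).cof ∧ f x = c} X g
    (fun b => (hc b).imp fun x hx => hx.symm) hX
  obtain ⟨w, hw⟩ := exists_nth_eq hv
  apply hA (a := w)
  refine ⟨fun l => ?_, fun l => ?_, fun l m => ?_, ?_⟩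
  · exact hw l ▸ (hvS l).1
  · exact hw l ▸ (hvS l).2.1
  · rw [hw, hw, (hvS l).2.2, (hvS m).2.2]
  · simpa only [hw] using hvg

theorem exists_gt_of_isCofinal (hmu : mu.IsRegular) {S : Set mu.ord.ToType} (hS : IsCofinal S)
    (b : mu.ord.ToType) : ∃ x ∈ S, b < x := by
  obtain ⟨z, hz⟩ := exists_forall_lt_of_mk_lt hmu (s := {b}) (by simpa using hmu.nat_lt 1)
  obtain ⟨x, hx, hzx⟩ := hS z
  exact ⟨x, hx, (hz b rfl).trans_le hzx⟩

theorem exists_isCofinal_fiber (hmu : mu.IsRegular) {S : Set mu.ord.ToType} (hS : IsCofinal S)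
    {X : Type u} (hX : #X < mu) (f : mu.ord.ToType → X) :
    ∃ c, IsCofinal {x | x ∈ S ∧ f x = c} := by
  by_contra! h
  simp only [not_isCofinal_iff] at h
  choose b hb using h
  obtain ⟨z, hz⟩ := exists_forall_lt_of_family hmu hX b
  obtain ⟨x, hx, hzx⟩ := hS z
  exact (hb (f x) x ⟨hx, rfl⟩).not_ge ((hz _).le.trans hzx)

/-- Each `x` has a colour `c x` that `g x` takes cofinally often, and `c` is constant on a cofinal
set; 0 and 3 are chosen there, and each is followed by two points of its own fibre. -/
theorem exists_strictMono_pairs6 (hmu : mu.IsRegular) {S : Set mu.ord.ToType} {X : Type u}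
    (g : mu.ord.ToType → mu.ord.ToType → X) (hS : IsCofinal S) (hX : #X < mu) :
    ∃ v : Fin 6 → mu.ord.ToType, StrictMono v ∧ (∀ l, v l ∈ S) ∧
      ∀ p ∈ pairs6, ∀ q ∈ pairs6, g (v p.1) (v p.2) = g (v q.1) (v q.2) := by
  choose c hc using fun x => exists_isCofinal_fiber hmu hS hX (g x)
  obtain ⟨d, hd⟩ := exists_isCofinal_fiber hmu hS hX c
  obtain ⟨x0, ⟨h0, h0d⟩, -⟩ := hd (Classical.choice (by simpa using hmu.ne_zero))
  obtain ⟨x1, ⟨h1, h1d⟩, h01⟩ := exists_gt_of_isCofinal hmu (hc x0) x0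
  obtain ⟨x2, ⟨h2, h2d⟩, h12⟩ := exists_gt_of_isCofinal hmu (hc x0) x1
  obtain ⟨x3, ⟨h3, h3d⟩, h23⟩ := exists_gt_of_isCofinal hmu hd x2
  obtain ⟨x4, ⟨h4, h4d⟩, h34⟩ := exists_gt_of_isCofinal hmu (hc x3) x3
  obtain ⟨x5, ⟨h5, h5d⟩, h45⟩ := exists_gt_of_isCofinal hmu (hc x3) x4
  refine ⟨![x0, x1, x2, x3, x4, x5], Fin.strictMono_iff_lt_succ.2 fun i => ?_, fun i => ?_, ?_⟩
  · fin_cases i <;> assumption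
  · fin_cases i <;> assumption
  · have : ∀ p ∈ pairs6, g (![x0, x1, x2, x3, x4, x5] p.1) (![x0, x1, x2, x3, x4, x5] p.2) = d := by
      rintro p (rfl | rfl | rfl | rfl)
      exacts [h1d.trans h0d, h2d.trans h0d, h4d.trans h3d, h5d.trans h3d]
    intro p hp q hq
    rw [this p hp, this q hq]

/-- Among `mu0⁺` fixed points of `S`, every `x` gives two the same colour. Fewer than `mu` outcomes
(the pair and its colour) are possible, so one recurs for cofinally many `x`. -/
theorem exists_strictMono_pairs4 (hmu : mu.IsRegular)
    (hlt : Order.succ mu0 < mu) {S : Set mu.ord.ToType} {X : Type u}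
    (g : mu.ord.ToType → mu.ord.ToType → X) (hS : IsCofinal S) (hX : #X ≤ mu0) :
    ∃ v : Fin 4 → mu.ord.ToType, StrictMono v ∧ (∀ l, v l ∈ S) ∧
      ∀ p ∈ pairs4, ∀ q ∈ pairs4, g (v p.1) (v p.2) = g (v q.1) (v q.2) := by
  obtain ⟨j⟩ : Nonempty ((Order.succ mu0).ord.ToType ↪ S) := by
    rw [← Cardinal.le_def]
    simpa using hlt.le.trans ((cof_toType_of_isRegular hmu).symm.le.trans (Order.cof_le hS))
  obtain ⟨b, hb⟩ := exists_forall_lt_of_family hmu (by simpa using hlt) (fun i => (j i).1)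
  have key : ∀ x, ∃ i i', (j i).1 < (j i').1 ∧ g (j i) x = g (j i') x := by
    intro x
    have hninj : ¬ Function.Injective (fun i => g (j i) x) := fun hinj => by
      have := mk_le_of_injective hinj
      rw [mk_ord_toType] at this
      exact ((Order.lt_succ mu0).trans_le this).not_ge hX
    simp only [Function.Injective, not_forall] at hninj
    obtain ⟨i, i', h, hne⟩ := hninj
    have hne' : (j i).1 ≠ (j i').1 := fun h => hne (j.injective (Subtype.ext h))
    obtain h' | h' := hne'.lt_or_gt
    exacts [⟨i, i', h', h⟩, ⟨i', i, h', h.symm⟩]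
  choose i i' hii hg using key
  obtain ⟨⟨a, a', c⟩, hc⟩ := exists_isCofinal_fiber hmu hS
    (X := (Order.succ mu0).ord.ToType × (Order.succ mu0).ord.ToType × X) (by
      simp only [mk_prod, Cardinal.lift_id, mk_ord_toType]
      exact mul_lt_of_lt hmu.aleph0_le hlt (mul_lt_of_lt hmu.aleph0_le hlt
        (hX.trans_lt ((Order.lt_succ mu0).trans hlt)))) (fun x => (i x, i' x, g (j (i x)) x))
  obtain ⟨x2, ⟨h2, h2c⟩, hb2⟩ := exists_gt_of_isCofinal hmu hc b
  obtain ⟨x3, ⟨h3, h3c⟩, h23⟩ := exists_gt_of_isCofinal hmu hc x2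
  simp only [Prod.mk.injEq] at h2c h3c
  obtain ⟨rfl, rfl, rfl⟩ := h2c
  obtain ⟨h3i, h3i', h3g⟩ := h3c
  have e3 := hg x3
  rw [h3g, h3i'] at e3
  rw [h3i] at h3g
  refine ⟨![j (i x2), j (i' x2), x2, x3], Fin.strictMono_iff_lt_succ.2 fun l => ?_,
    fun l => ?_, ?_⟩
  · fin_cases l
    exacts [hii x2, (hb _).trans hb2, h23]
  · fin_cases l
    exacts [(j _).2, (j _).2, h2, h3]
  · have : ∀ p ∈ pairs4, g (![(j (i x2)).1, j (i' x2), x2, x3] p.1)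
        (![(j (i x2)).1, j (i' x2), x2, x3] p.2) = g (j (i x2)) x2 := by
      rintro p (rfl | rfl | rfl | rfl)
      exacts [rfl, h3g, (hg x2).symm, e3.symm]
    intro p hp q hq
    rw [this p hp, this q hq]

end Proper

/-! ### Finite cut descriptions of interval algebra elements. -/

section IntervalAlgebra

variable {I : Type v} [LinearOrder I]

/-- The number of members of `T` that are at most `x`. -/
def cutCount (T : Finset I) (x : WithTop I) : ℕ :=
  (T.filter fun s : I => (s : WithTop I) ≤ x).card

theorem cutCount_mono (T : Finset I) : Monotone (cutCount T) := fun _ _ h =>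
  Finset.card_le_card (Finset.monotone_filter_right T fun _ _ hs => hs.trans h)

theorem exists_between_of_cutCount_lt {T : Finset I} {x y : WithTop I}
    (h : cutCount T x < cutCount T y) : ∃ s ∈ T, x < s ∧ (s : WithTop I) ≤ y := by
  by_contra! hs
  refine h.not_ge (Finset.card_le_card fun s hsT => ?_)
  rw [Finset.mem_filter] at hsT ⊢
  exact ⟨hsT.1, not_lt.1 fun hx => (hs s hsT.1 hx).not_ge hsT.2⟩

theorem exists_finset_of_mem_intervalAlgebra {s : Set I} (hs : s ∈ intervalAlgebra I) :
    ∃ T : Finset I, ∀ z z' : I, (∀ t ∈ T, t ≤ z ↔ t ≤ z') → (z ∈ s ↔ z' ∈ s) := by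
  classical
  have key : ∀ x : WithBot (WithTop I), ∃ T : Finset I, ∀ z z' : I,
      (∀ t ∈ T, t ≤ z ↔ t ≤ z') →
        (x ≤ ((z : WithTop I) : WithBot (WithTop I)) ↔
          x ≤ ((z' : WithTop I) : WithBot (WithTop I))) := by
    intro x
    induction x with
    | bot => exact ⟨∅, by simp⟩
    | coe x =>
      induction x with
      | top => exact ⟨∅, by simp⟩
      | coe x => exact ⟨{x}, by simp⟩
  induction hs using BooleanSubalgebra.closure_bot_sup_induction with
  | mem s hs =>
    obtain ⟨x, y, rfl⟩ := hs
    obtain ⟨T, hT⟩ := key x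
    obtain ⟨T', hT'⟩ := key y
    refine ⟨T ∪ T', fun z z' h => ?_⟩
    have h1 := hT z z' fun t ht => h t (Finset.mem_union_left _ ht)
    have h2 := hT' z z' fun t ht => h t (Finset.mem_union_right _ ht)
    simp only [Set.mem_ofPred_eq, h1, ← not_le, h2]
  | bot => exact ⟨∅, by simp⟩
  | sup s _ s' _ ih ih' =>
    obtain ⟨T, hT⟩ := ih
    obtain ⟨T', hT'⟩ := ih'
    refine ⟨T ∪ T', fun z z' h => ?_⟩
    have h1 := hT z z' fun t ht => h t (Finset.mem_union_left _ ht)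
    have h2 := hT' z z' fun t ht => h t (Finset.mem_union_right _ ht)
    simp [h1, h2]
  | compl s _ ih =>
    obtain ⟨T, hT⟩ := ih
    exact ⟨T, fun z z' h => not_congr (hT z z' h)⟩

/-- The sets of cuts at or below the various points form a chain, so equal cardinality forces
equality. -/
theorem exists_mem_iff_cutCount_mem {s : Set I} (hs : s ∈ intervalAlgebra I) :
    ∃ (T : Finset I) (V : Set ℕ), ∀ z : I, z ∈ s ↔ cutCount T z ∈ V := by
  obtain ⟨T, hT⟩ := exists_finset_of_mem_intervalAlgebra hs
  refine ⟨T, {n | ∃ z ∈ s, cutCount T z = n}, fun z => ⟨fun hz => ⟨z, hz, rfl⟩, ?_⟩⟩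
  rintro ⟨z', hz', h⟩
  refine (hT z' z fun t ht => ⟨fun h1 => ?_, fun h1 => ?_⟩).1 hz'
  · by_contra! h2
    refine h.not_gt (Finset.card_lt_card ⟨Finset.monotone_filter_right T fun a _ ha =>
      ha.trans (WithTop.coe_le_coe.2 (h2.le.trans h1)), fun h3 => ?_⟩)
    have := h3 (Finset.mem_filter.2 ⟨ht, WithTop.coe_le_coe.2 h1⟩)
    exact h2.not_ge (WithTop.coe_le_coe.1 (Finset.mem_filter.1 this).2)
  · by_contra! h2
    refine h.not_lt (Finset.card_lt_card ⟨Finset.monotone_filter_right T fun a _ ha =>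
      ha.trans (WithTop.coe_le_coe.2 (h2.le.trans h1)), fun h3 => ?_⟩)
    have := h3 (Finset.mem_filter.2 ⟨ht, WithTop.coe_le_coe.2 h1⟩)
    exact h2.not_ge (WithTop.coe_le_coe.1 (Finset.mem_filter.1 this).2)

theorem exists_enumeration (T : Finset I) : ∃ t : ℕ → WithTop I,
    (∀ l (z : I), t l ≤ z ↔ l < cutCount T z) ∧ ∀ s ∈ T, ∃ m, t m = s := by
  let e := T.orderEmbOfFin rfl
  have hcount : ∀ z : I, cutCount T z = (Finset.univ.filter fun i => e i ≤ z).card := by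
    intro z
    have : (T.filter fun s : I => (s : WithTop I) ≤ z) =
        (Finset.univ.filter fun i => e i ≤ z).map e.toEmbedding := by
      ext s
      simp only [Finset.mem_filter, WithTop.coe_le_coe, Finset.mem_map, Finset.mem_univ, true_and,
        RelEmbedding.coe_toEmbedding]
      constructor
      · rintro ⟨hs, hsz⟩
        obtain ⟨i, rfl⟩ : s ∈ Set.range e := by simpa [e] using hs
        exact ⟨i, hsz, rfl⟩
      · rintro ⟨i, hi, rfl⟩
        exact ⟨T.orderEmbOfFin_mem rfl i, hi⟩
    rw [cutCount, this, Finset.card_map]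
  -- Past the last cut the value `⊤` is above every point, matching the bound `cutCount T z ≤
  -- T.card`.
  refine ⟨fun l => if h : l < T.card then (e ⟨l, h⟩ : WithTop I) else ⊤, fun l z => ?_,
    fun s hs => ?_⟩
  · rw [hcount]
    dsimp only
    by_cases h : l < T.card
    · rw [dif_pos h, WithTop.coe_le_coe]
      constructor
      · intro hl
        calc l < (Finset.Iic (⟨l, h⟩ : Fin T.card)).card := by simp
          _ ≤ _ := Finset.card_le_card fun i hi => by
            simpa using (e.monotone (Finset.mem_Iic.1 hi)).trans hl
      · intro hl
        by_contra! hz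
        refine hl.not_ge ?_
        calc _ ≤ (Finset.Iio (⟨l, h⟩ : Fin T.card)).card := Finset.card_le_card fun i hi => by
              rw [Finset.mem_Iio]
              exact e.lt_iff_lt.1 ((Finset.mem_filter.1 hi).2.trans_lt hz)
          _ = l := by simp
    · rw [dif_neg h]
      have := (Finset.univ.filter fun i => e i ≤ z).card_le_univ
      rw [Fintype.card_fin] at this
      simp only [top_le_iff, WithTop.coe_ne_top, false_iff, not_lt]
      exact this.trans (not_lt.1 h)
  · obtain ⟨i, rfl⟩ : s ∈ Set.range e := by simpa [e] using hs
    exact ⟨i, by simp⟩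

/-- The point `z` separates `x` and `y`. -/
def Separates (z x y : WithTop I) : Prop := x ≤ z ∧ z < y ∨ y ≤ z ∧ z < x

theorem Separates.cutCount_eq {z x y : WithTop I} (h : Separates z x y) {T : Finset I}
    (hT : cutCount T x = cutCount T y) : cutCount T z = cutCount T x := by
  obtain h | h := h
  · exact le_antisymm (hT ▸ cutCount_mono T h.2.le) (cutCount_mono T h.1)
  · exact le_antisymm (cutCount_mono T h.2.le) (hT ▸ cutCount_mono T h.1)

theorem exists_separates {T T' : Finset I} {t t' : ℕ → WithTop I}
    (ht : ∀ l (z : I), t l ≤ z ↔ l < cutCount T z)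
    (ht' : ∀ l (z : I), t' l ≤ z ↔ l < cutCount T' z) {z : I} (h : cutCount T z ≠ cutCount T' z) :
    ∃ l, Separates z (t l) (t' l) := by
  obtain h | h := h.lt_or_gt
  -- Enumeration starts at 0, so the smaller count is the index of the first cut above `z` on one
  -- side, while on the other side that cut is at or below `z`.
  · exact ⟨cutCount T z, .inr ⟨(ht' _ _).2 h, not_le.1 fun h' => ((ht _ _).1 h').false⟩⟩
  · exact ⟨cutCount T' z, .inl ⟨(ht _ _).2 h, not_le.1 fun h' => ((ht' _ _).1 h').false⟩⟩

end IntervalAlgebra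

/-! ### Uniformization modulo the filter and the dependence properties. -/

section Dependence

variable {mu kappa : Cardinal.{u}} {k : ℕ} {P : Cardinal.{u} → Prop}

/-- Modulo the pattern filter, either one `j` lies between `t x l` and `t x l'` for all members
`x` of a tuple, or no term of an earlier sequence lies between them. -/
theorem Admissible.eventually_separated (h : Admissible mu kappa P) (E : Set (Fin k × Fin k))
    {J : Type v} [LinearOrder J] (t : mu.ord.ToType → ℕ → J) :
    ∀ᶠ w in patFilter mu kappa E P, ∀ l l' : ℕ,
      (∃ j, ∀ i, t (nth w i) l < j ∧ j ≤ t (nth w i) l') ∨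
      ∀ i, ∀ y < nth w i, ∀ m, t (nth w i) l < t y m → ¬ t y m ≤ t (nth w i) l' := by
  have := h.countableInterFilter E
  refine eventually_countable_forall.2 fun l => eventually_countable_forall.2 fun l' => ?_
  let Sep : mu.ord.ToType → Set (mu.ord.ToType × ℕ) := fun x =>
    {p | p.1 < x ∧ t x l < t p.1 p.2 ∧ t p.1 p.2 ≤ t x l'}
  obtain ⟨o, ho⟩ := h.exists_isMin
  -- A witness `(y, m)` splits into a regressive part `y` and a countable part `m`, both constant
  -- along a tuple; the term it names is then the common `j`.
  have hF : ∀ x, ∃ p : mu.ord.ToType × Option ℕ, (p.1 < x ∨ IsMin p.1) ∧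
      ((∃ m, p.2 = some m ∧ (p.1, m) ∈ Sep x) ∨ p.2 = none ∧ Sep x = ∅) := by
    intro x
    obtain hx | ⟨⟨y, m⟩, hx⟩ := (Sep x).eq_empty_or_nonempty
    · exact ⟨(o, none), .inr ho, .inr ⟨rfl, hx⟩⟩
    · exact ⟨(y, some m), .inl hx.1, .inl ⟨m, rfl, hx⟩⟩
  choose F hF hF' using hF
  filter_upwards [h.eventually_regressive_eq E (regressive_of_lt_or_isMin hF),
    h.eventually_countable_eq E (fun x => (F x).2)] with w hw hw'
  by_cases hn : ∃ i, (Sep (nth w i)).Nonempty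
  · obtain ⟨i, hi⟩ := hn
    obtain ⟨m, hm, hs⟩ | ⟨-, h0⟩ := hF' (nth w i)
    · refine .inl ⟨t (F (nth w i)).1 m, fun i' => ?_⟩
      obtain ⟨m', hm', hs'⟩ | ⟨h0, -⟩ := hF' (nth w i')
      · rw [hw' i' i, hm, Option.some.injEq] at hm'
        rw [hw i' i, ← hm'] at hs'
        exact hs'.2
      · rw [hw' i' i, hm] at h0
        exact absurd h0 (by simp)
    · exact absurd hi (by simp [h0])
  · exact .inr fun i y hy m h1 h2 => hn ⟨i, (y, m), hy, h1, h2⟩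

theorem nth_strictMono (w : Tup mu k) : StrictMono (nth w) :=
  (Finset.orderEmbOfFin _ _).strictMono

/-- In an interval algebra, sequences of elements are described by finite sets of cuts, and
modulo the pattern filter the descriptions are uniform. -/
theorem Admissible.exists_cuts (h : Admissible mu kappa P) (E : Set (Fin k × Fin k))
    {I : Type v} [LinearOrder I] (S : mu.ord.ToType → Set I)
    (hS : ∀ x, S x ∈ intervalAlgebra I) :
    ∃ (T : mu.ord.ToType → Finset I) (t : mu.ord.ToType → ℕ → WithTop I),
      (∀ x, ∀ s ∈ T x, ∃ m, t x m = s) ∧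
      ∀ᶠ w in patFilter mu kappa E P,
        (∀ l m (z : I), cutCount (T (nth w l)) z = cutCount (T (nth w m)) z →
          (z ∈ S (nth w l) ↔ z ∈ S (nth w m))) ∧
        (∀ l m (z : I), z ∈ S (nth w l) → z ∉ S (nth w m) →
          ∃ n, Separates z (t (nth w l) n) (t (nth w m) n)) ∧
        ∀ n, ∀ p ∈ E, ∀ q ∈ E, cutCount (T (nth w p.1)) (t (nth w p.2) n) =
          cutCount (T (nth w q.1)) (t (nth w q.2) n) := by
  have := h.countableInterFilter E
  choose T V hV using fun x => exists_mem_iff_cutCount_mem (hS x)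
  choose t ht htT using fun x => exists_enumeration (T x)
  refine ⟨T, t, htT, ?_⟩
  -- `V` may take continuum many values, so it is stabilized one bit at a time, using countable
  -- completeness.
  have hVw : ∀ᶠ w in patFilter mu kappa E P, ∀ n l m,
      (n ∈ V (nth w l)) = (n ∈ V (nth w m)) :=
    eventually_countable_forall.2 fun n => h.eventually_countable_eq E (fun x => n ∈ V x)
  have hg : ∀ᶠ w in patFilter mu kappa E P, ∀ n, ∀ p ∈ E, ∀ q ∈ E,
      cutCount (T (nth w p.1)) (t (nth w p.2) n) = cutCount (T (nth w q.1)) (t (nth w q.2) n) :=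
    eventually_countable_forall.2 fun n =>
      h.eventually_colour_eq E (fun x y => cutCount (T x) (t y n))
  filter_upwards [hVw, hg] with w hVw hg
  have h1 : ∀ l m (z : I), cutCount (T (nth w l)) z = cutCount (T (nth w m)) z →
      (z ∈ S (nth w l) ↔ z ∈ S (nth w m)) := fun l m z hz => by
    rw [hV, hV, hz, hVw _ l m]
  exact ⟨h1, fun l m z hl hm => exists_separates (ht _) (ht _) fun hz =>
    hm ((h1 l m z hz).1 hl), hg⟩

theorem Admissible.dependenceProperty_tau4 (h : Admissible mu kappa P) (B : Type v)
    [BooleanAlgebra B] (hB : IsIntervalAlgebra B) :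
    DependenceProperty (patFilter mu kappa pairs4 P) tau4 B := by
  obtain ⟨I, _, ⟨e⟩⟩ := hB
  intro a
  obtain ⟨T, t, -, hw⟩ := h.exists_cuts pairs4 (fun x => (e (a x) : Set I)) fun x => (e (a x)).2
  refine ⟨_, hw, fun w ⟨h1, h2, h3⟩ => ?_⟩
  apply e.injective
  rw [map_bot, Subtype.ext_iff]
  refine Set.eq_empty_of_forall_notMem fun z hz => ?_
  have hz' : ((z ∈ (e (a (nth w 0)) : Set I) ∧ z ∉ (e (a (nth w 1)) : Set I)) ∧
      z ∈ (e (a (nth w 2)) : Set I)) ∧ z ∉ (e (a (nth w 3)) : Set I) := by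
    simpa [tau4, BTerm.eval, map_compl'] using hz
  obtain ⟨⟨⟨z0, z1⟩, z2⟩, z3⟩ := hz'
  obtain ⟨n, hn⟩ := h2 2 3 z z2 z3
  have e0 := hn.cutCount_eq (h3 n (0, 2) (by simp [pairs4]) (0, 3) (by simp [pairs4]))
  have e1 := hn.cutCount_eq (h3 n (1, 2) (by simp [pairs4]) (1, 3) (by simp [pairs4]))
  have e2 := h3 n (0, 2) (by simp [pairs4]) (1, 2) (by simp [pairs4])
  exact z1 ((h1 0 1 z (e0.trans (e2.trans e1.symm))).1 z0)

theorem Admissible.dependenceProperty_tau6 (h : Admissible mu kappa P) (B : Type v)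
    [BooleanAlgebra B] (hB : IsIntervalAlgebra B) :
    DependenceProperty (patFilter mu kappa pairs6 P) tau6 B := by
  obtain ⟨I, _, ⟨e⟩⟩ := hB
  intro a
  obtain ⟨T, t, htT, hw⟩ := h.exists_cuts pairs6 (fun x => (e (a x) : Set I)) fun x => (e (a x)).2
  refine ⟨_, Filter.inter_mem hw (h.eventually_separated pairs6 t), fun w ⟨⟨h1, h2, h3⟩, h4⟩ => ?_⟩
  apply e.injective
  rw [map_bot, Subtype.ext_iff]
  refine Set.eq_empty_of_forall_notMem fun z hz => ?_
  have hz' : ((((z ∈ (e (a (nth w 0)) : Set I) ∧ z ∉ (e (a (nth w 1)) : Set I)) ∧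
      z ∈ (e (a (nth w 2)) : Set I)) ∧ z ∉ (e (a (nth w 3)) : Set I)) ∧
      z ∈ (e (a (nth w 4)) : Set I)) ∧ z ∉ (e (a (nth w 5)) : Set I) := by
    simpa [tau6, BTerm.eval, map_compl'] using hz
  obtain ⟨⟨⟨⟨⟨z0, z1⟩, z2⟩, z3⟩, z4⟩, z5⟩ := hz'
  obtain ⟨n, hn⟩ := h2 2 1 z z2 z1
  obtain ⟨n', hn'⟩ := h2 4 5 z z4 z5
  have bounds : ∀ {i i' : Fin 6} {n : ℕ}, Separates (z : WithTop I) (t (nth w i) n)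
      (t (nth w i') n) → (∃ i, t (nth w i) n ≤ z) ∧ ∃ i, (z : WithTop I) < t (nth w i) n := by
    rintro i i' n (hs | hs)
    exacts [⟨⟨_, hs.1⟩, ⟨_, hs.2⟩⟩, ⟨⟨_, hs.1⟩, ⟨_, hs.2⟩⟩]
  -- Otherwise some cut of index 0 lies between the two cuts of index 1, so the dichotomy gives a
  -- single `j` above all `n`-th cuts and at or below all `n'`-th cuts of the tuple, whence `z < j ≤
  -- z`.
  have sep : ∀ {n n' : ℕ}, (∃ i, (z : WithTop I) < t (nth w i) n) →
      (∃ i, t (nth w i) n' ≤ z) →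
      cutCount (T (nth w 0)) (t (nth w 1) n') ≤ cutCount (T (nth w 0)) (t (nth w 1) n) := by
    rintro n n' ⟨i, hi⟩ ⟨i', hi'⟩
    by_contra! hlt
    obtain ⟨s, hs, hs1, hs2⟩ := exists_between_of_cutCount_lt hlt
    obtain ⟨m, hm⟩ := htT _ s hs
    obtain ⟨j, hj⟩ | hno := h4 n n'
    · exact absurd ((hi.trans (hj i).1).trans_le ((hj i').2.trans hi')) (lt_irrefl _)
    · rw [← hm] at hs1 hs2
      exact hno 1 (nth w 0) (nth_strictMono w (by decide)) m hs1 hs2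
  have e0 := hn.cutCount_eq (h3 n (0, 2) (by simp [pairs6]) (0, 1) (by simp [pairs6]))
  have e3 := hn'.cutCount_eq (h3 n' (3, 4) (by simp [pairs6]) (3, 5) (by simp [pairs6]))
  -- Each of the `n`-th and `n'`-th cuts has members of the tuple on both sides of `z`, so `sep`
  -- applies both ways.
  have e1 : cutCount (T (nth w 0)) (t (nth w 1) n) = cutCount (T (nth w 0)) (t (nth w 1) n') :=
    le_antisymm (sep (bounds hn').2 (bounds hn).1) (sep (bounds hn).2 (bounds hn').1)
  have e2 := h3 n (0, 2) (by simp [pairs6]) (0, 1) (by simp [pairs6])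
  have e4 := h3 n' (0, 1) (by simp [pairs6]) (3, 4) (by simp [pairs6])
  exact z3 ((h1 0 3 z (e0.trans (e2.trans (e1.trans (e4.trans e3.symm))))).1 z0)

end Dependence

end IntervalDependence

theorem mainTheorem8 (kappa mu : Cardinal.{u}) (hkappa : ℵ₀ ≤ kappa) (hmu : mu.IsRegular)
    (hpow : ∀ χ < mu, χ ^ kappa < mu) :
    ((D6 mu kappa).NeBot ∧
      CardinalInterFilter (D6 mu kappa) (Order.succ kappa) ∧
      NormalFor (D6 mu kappa) (fun _ => mu.ord) ∧
      ∀ (B : Type v) [BooleanAlgebra B], IsIntervalAlgebra B →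
        DependenceProperty (D6 mu kappa) tau6 B) ∧
    (∀ mu0 : Cardinal.{u}, ℵ₀ ≤ mu0 → mu0 ^ kappa = mu0 → Order.succ (2 ^ mu0) ≤ mu →
      (D4 mu kappa mu0 hkappa).NeBot ∧
      CardinalInterFilter (D4 mu kappa mu0 hkappa) (Order.succ kappa) ∧
      NormalFor (D4 mu kappa mu0 hkappa) (fun _ => mu.ord) ∧
      ∀ (B : Type v) [BooleanAlgebra B], IsIntervalAlgebra B →
        DependenceProperty (D4 mu kappa mu0 hkappa) tau4 B) := by
  refine ⟨?_, fun mu0 hmu0 hmu0' hmu0'' => ?_⟩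
  · have h := admissible_lt hkappa hmu hpow
    rw [D6_eq_patFilter]
    exact ⟨h.neBot_patFilter pairs6 fun S X g hS hX => exists_strictMono_pairs6 hmu g hS hX,
      h.cardinalInterFilter pairs6, h.normalFor pairs6,
      fun B _ hB => h.dependenceProperty_tau6 B hB⟩
  · have h := admissible_le hkappa hmu hpow hmu0 hmu0'
    rw [D4_eq_patFilter h]
    have hsucc : Order.succ mu0 < mu :=
      (Order.succ_le_of_lt (cantor mu0)).trans_lt (Order.succ_le_iff.1 hmu0'')
    exact ⟨h.neBot_patFilter pairs4 fun S X g hS hX => exists_strictMono_pairs4 hmu hsucc g hS hX,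
      h.cardinalInterFilter pairs4, h.normalFor pairs4,
      fun B _ hB => h.dependenceProperty_tau4 B hB⟩
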